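/- Let $k$ be a perfect field with $\operatorname{char}(k)\neq 2$, with algebraic closure $\overline{k}$ and absolute Galois group $\mathfrak g_k=\operatorname{Gal}(\overline k/k)$, and let $n$ be an odd positive integer. Let $\mathcal G$ be an abstract theta group over $k$ of type $\underline{n}=(n,\dots,n)$. That is, $\mathcal G$ is a group scheme of finite type over $k$ in a short exact sequence of $k$-group schemes \[1\to\mathbb G_m\to\mathcal G\to K\to 1\] such that the center of $\mathcal G$ is $\mathbb G_m$, the group scheme $K$ is finite étale over $k$, its order is not divisible by $\operatorname{char}(k)$, and there is an isomorphism of abstract groups $K(\overline k)\cong(\mathbb Z/n\mathbb Z)^g\oplus(\mathbb Z/n\mathbb Z)^g$ for some integer $g\ge 0$. Let \[\Delta_{\mathcal G}: H^1(k,K)\to H^2(k,\mathbb G_m)=\operatorname{Br}(k)\] be the connecting map of this central extension in (continuous) Galois cohomology: if $\eta:\mathfrak g_k\to K(\overline k)$ is a continuous $1$-cocycle and $N:\mathfrak g_k\to\mathcal G(\overline k)$ is any continuous lift of it, then $\Delta_{\mathcal G}([\eta])$ is the class of the $2$-cocycle $(\sigma,\tau)\mapsto N_\sigma\,\sigma(N_\tau)\,N_{\sigma\tau}^{-1}\in\overline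 k^{\times}$. Then \[\Delta_{\mathcal G}\bigl(H^1(k,K)\bigr)\subset \operatorname{Br}(k)[n].\] -/

import Mathlib

namespace ThetaObstruction

section Cohomology

variable (Γ : Type*) [Group Γ] [TopologicalSpace Γ]

/-- Continuous `1`-cocycles of `Γ` with values in a discrete (possibly non-abelian) `Γ`-group `M`. -/
def Z1 (M : Type*) [Group M] [MulDistribMulAction Γ M] : Type _ :=
  {a : Γ → M // IsLocallyConstant a ∧ ∀ σ τ, a (σ * τ) = a σ * σ • a τ}

/-- Two `1`-cocycles are cohomologous if `b σ = m⁻¹ · a σ · σ(m)` for some `m`. -/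
def Z1.setoid (M : Type*) [Group M] [MulDistribMulAction Γ M] : Setoid (Z1 Γ M) where
  r a b := ∃ m : M, ∀ σ, b.1 σ = m⁻¹ * a.1 σ * σ • m
  iseqv :=
    { refl := fun a => ⟨1, fun σ => by simp⟩
      symm := by
        rintro a b ⟨m, h⟩
        exact ⟨m⁻¹, fun σ => by rw [h σ]; simp [mul_assoc]⟩
      trans := by
        rintro a b c ⟨m, h⟩ ⟨m', h'⟩
        exact ⟨m * m', fun σ => by rw [h' σ, h σ]; simp [mul_assoc]⟩ }

/-- The first continuous cohomology set `H¹(Γ, M)` (the usual group `H¹` when `M` is abelian,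
regarded as a set). -/
def H1 (M : Type*) [Group M] [MulDistribMulAction Γ M] : Type _ :=
  Quotient (Z1.setoid Γ M)

variable (C : Type*) [CommGroup C] [MulDistribMulAction Γ C]

/-- The group of continuous inhomogeneous `2`-cocycles of `Γ` in the discrete module `C`
(written multiplicatively). -/
def Z2 : Subgroup (Γ × Γ → C) where
  carrier := {c | IsLocallyConstant c ∧
    ∀ ρ σ τ, ρ • c (σ, τ) * c (ρ, σ * τ) = c (ρ * σ, τ) * c (ρ, σ)}
  one_mem' := ⟨IsLocallyConstant.const 1, fun ρ σ τ => by simp⟩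
  mul_mem' := by
    rintro c c' ⟨h1, h2⟩ ⟨h1', h2'⟩
    refine ⟨h1.mul h1', fun ρ σ τ => ?_⟩
    simp only [Pi.mul_apply, smul_mul']
    rw [mul_mul_mul_comm, h2, h2', mul_mul_mul_comm]
  inv_mem' := by
    rintro c ⟨h1, h2⟩
    refine ⟨h1.inv, fun ρ σ τ => ?_⟩
    simp only [Pi.inv_apply, smul_inv']
    rw [← mul_inv, h2, mul_inv]

/-- The group of coboundaries `(σ, τ) ↦ b σ · σ(b τ) · b(στ)⁻¹` of continuous `1`-cochains `b`. -/
def B2 : Subgroup (Γ × Γ → C) where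
  carrier := {c | ∃ b : Γ → C, IsLocallyConstant b ∧
    ∀ σ τ, c (σ, τ) = b σ * σ • b τ * (b (σ * τ))⁻¹}
  one_mem' := ⟨1, IsLocallyConstant.const 1, fun σ τ => by simp⟩
  mul_mem' := by
    rintro c c' ⟨b, hb, h⟩ ⟨b', hb', h'⟩
    refine ⟨b * b', hb.mul hb', fun σ τ => ?_⟩
    simp only [Pi.mul_apply, smul_mul', mul_inv, h, h']
    simp only [mul_left_comm, mul_assoc]
  inv_mem' := by
    rintro c ⟨b, hb, h⟩
    refine ⟨b⁻¹, hb.inv, fun σ τ => ?_⟩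
    simp only [Pi.inv_apply, smul_inv', h, mul_inv]

/-- The second continuous cohomology group `H²(Γ, C)`, written multiplicatively. -/
def H2 : Type _ := Z2 Γ C ⧸ (B2 Γ C).subgroupOf (Z2 Γ C)

instance : CommGroup (H2 Γ C) :=
  inferInstanceAs (CommGroup (Z2 Γ C ⧸ (B2 Γ C).subgroupOf (Z2 Γ C)))

variable {Γ C} in
/-- The class in `H²(Γ, C)` of a `2`-cocycle. -/
def H2.mk : Z2 Γ C →* H2 Γ C := QuotientGroup.mk' ((B2 Γ C).subgroupOf (Z2 Γ C))

variable {Γ C} in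
lemma H2.mk_eq_mk {c c' : Z2 Γ C} : H2.mk c = H2.mk c' ↔ c.1⁻¹ * c'.1 ∈ B2 Γ C := by
  refine QuotientGroup.eq.trans ?_
  rw [Subgroup.mem_subgroupOf]
  rfl

end Cohomology

section Connecting

variable {Γ : Type*} [Group Γ] [TopologicalSpace Γ]
variable {C G K : Type*} [CommGroup C] [Group G] [Group K]
variable [MulDistribMulAction Γ C] [MulDistribMulAction Γ G] [MulDistribMulAction Γ K]

variable (Γ) in
/-- `1 → C → G → K → 1` is a central extension of discrete groups with continuous `Γ`-action. -/
structure IsCentralExtension (i : C →* G) (p : G →* K) : Prop where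
  injective : Function.Injective i
  surjective : Function.Surjective p
  exact : i.range = p.ker
  central : ∀ c g, i c * g = g * i c
  map_smul_left : ∀ (σ : Γ) c, i (σ • c) = σ • i c
  map_smul_right : ∀ (σ : Γ) g, p (σ • g) = σ • p g
  /-- The action on `G` is continuous for the discrete topology of `G`. -/
  continuous_smul : ∀ g : G, IsLocallyConstant fun σ : Γ => σ • g

/-- `N` is a continuous lift to `G` of the cochain `a : Γ → K`, and `c` is the `C`-valued
`2`-cochain `(σ, τ) ↦ N σ · σ(N τ) · N(στ)⁻¹`. -/
def IsLiftWithCoboundary (i : C →* G) (p : G →* K) (a : Γ → K) (N : Γ → G) (c : Γ × Γ → C) :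
    Prop :=
  IsLocallyConstant N ∧ (∀ σ, p (N σ) = a σ) ∧
    ∀ σ τ, i (c (σ, τ)) = N σ * σ • N τ * (N (σ * τ))⁻¹

namespace IsCentralExtension

variable {i : C →* G} {p : G →* K}

lemma exists_lift (h : IsCentralExtension Γ i p) (a : Z1 Γ K) : ∃ N c, IsLiftWithCoboundary i p a.1 N c := by
  choose s hs using h.surjective
  have key : ∀ στ : Γ × Γ, ∃ c, i c =
      s (a.1 στ.1) * στ.1 • s (a.1 στ.2) * (s (a.1 (στ.1 * στ.2)))⁻¹ := fun στ => by
    rw [← MonoidHom.mem_range, h.exact, MonoidHom.mem_ker]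
    simp [h.map_smul_right, hs, a.2.2]
  choose c hc using key
  exact ⟨fun σ => s (a.1 σ), c, a.2.1.comp s, fun σ => hs _, fun σ τ => hc (σ, τ)⟩

/-- The coboundary of a continuous lift is a continuous `2`-cocycle. -/
lemma mem_Z2 [IsTopologicalGroup Γ] (h : IsCentralExtension Γ i p) {a : Z1 Γ K} {N : Γ → G}
    {c : Γ × Γ → C} (hN : IsLiftWithCoboundary i p a.1 N c) :
    c ∈ Z2 Γ C := by
  obtain ⟨hN, hpN, hc⟩ := hN
  constructor
  · have h1 : IsLocallyConstant fun x : Γ × Γ => N x.1 := hN.comp_continuous continuous_fst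
    have h2 : IsLocallyConstant fun x : Γ × Γ => N (x.1 * x.2) :=
      hN.comp_continuous continuous_mul
    have h3 : IsLocallyConstant fun x : Γ × Γ => x.1 • N x.2 := by
      rw [IsLocallyConstant.iff_eventually_eq]
      intro x
      have e1 := (IsLocallyConstant.iff_eventually_eq _).1
        ((h.continuous_smul (N x.2)).comp_continuous (continuous_fst (X := Γ) (Y := Γ))) x
      have e2 := (IsLocallyConstant.iff_eventually_eq _).1
        (hN.comp_continuous (continuous_snd (X := Γ) (Y := Γ))) x
      filter_upwards [e1, e2] with y h1 h2
      simp only [Function.comp_apply] at h1 h2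
      rw [h2, h1]
    rw [IsLocallyConstant.iff_eventually_eq]
    intro x
    filter_upwards [(IsLocallyConstant.iff_eventually_eq _).1 h1 x,
      (IsLocallyConstant.iff_eventually_eq _).1 h2 x,
      (IsLocallyConstant.iff_eventually_eq _).1 h3 x] with y e1 e2 e3
    apply h.injective
    rw [show y = (y.1, y.2) from rfl, show x = (x.1, x.2) from rfl, hc, hc, e1, e2, e3]
  · intro ρ σ τ
    apply h.injective
    have e1 := h.central (ρ • c (σ, τ)) (N ρ)
    have e2 : N ρ * ρ • N σ = i (c (ρ, σ)) * N (ρ * σ) := by rw [hc]; group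
    have e3 : N σ * σ • N τ = i (c (σ, τ)) * N (σ * τ) := by rw [hc]; group
    have e4 : N ρ * ρ • N (σ * τ) = i (c (ρ, σ * τ)) * N (ρ * (σ * τ)) := by rw [hc]; group
    have e5 : N (ρ * σ) * (ρ * σ) • N τ = i (c (ρ * σ, τ)) * N (ρ * σ * τ) := by rw [hc]; group
    have e6 : N ρ * ρ • (N σ * σ • N τ) = N ρ * ρ • N σ * (ρ * σ) • N τ := by
      rw [smul_mul', mul_smul, mul_assoc]
    rw [e3, smul_mul', ← h.map_smul_left, ← mul_assoc, ← e1, mul_assoc, e4, e2, mul_assoc, e5,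
      mul_assoc ρ σ τ, ← mul_assoc, ← mul_assoc (i (c (ρ, σ))), mul_left_inj] at e6
    rw [map_mul, map_mul, e6, h.central]

/-- The class of the `2`-cocycle depends only on the cohomology class of the `1`-cocycle. -/
lemma coboundary_unique (h : IsCentralExtension Γ i p) {a a' : Z1 Γ K} (haa' : Z1.setoid Γ K a a') {N N' : Γ → G}
    {c c' : Γ × Γ → C} (hN : IsLiftWithCoboundary i p a.1 N c)
    (hN' : IsLiftWithCoboundary i p a'.1 N' c') : c⁻¹ * c' ∈ B2 Γ C := by
  obtain ⟨m, hm⟩ := haa'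
  obtain ⟨g, rfl⟩ := h.surjective m
  obtain ⟨hN, hpN, hc⟩ := hN
  obtain ⟨hN', hpN', hc'⟩ := hN'
  have key : ∀ σ, ∃ b, i b = N' σ * (g⁻¹ * N σ * σ • g)⁻¹ := fun σ => by
    rw [← MonoidHom.mem_range, h.exact, MonoidHom.mem_ker]
    simp [h.map_smul_right, hpN, hpN', hm, mul_assoc]
  choose b hb using key
  refine ⟨b, ?_, fun σ τ => ?_⟩
  · rw [IsLocallyConstant.iff_eventually_eq]
    intro x
    filter_upwards [(IsLocallyConstant.iff_eventually_eq _).1 hN x,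
      (IsLocallyConstant.iff_eventually_eq _).1 hN' x,
      (IsLocallyConstant.iff_eventually_eq _).1 (h.continuous_smul g) x] with y e1 e2 e3
    apply h.injective
    rw [hb, hb, e1, e2, e3]
  · have hb' : ∀ σ, N' σ = i (b σ) * (g⁻¹ * N σ * σ • g) := fun σ => by rw [hb]; group
    have hX : (g⁻¹ * N σ * σ • g) * σ • (g⁻¹ * N τ * τ • g) *
        (g⁻¹ * N (σ * τ) * (σ * τ) • g)⁻¹ = i (c (σ, τ)) := by
      have w : g⁻¹ * i (c (σ, τ)) * g = i (c (σ, τ)) := by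
        rw [mul_assoc, h.central, inv_mul_cancel_left]
      rw [← w, hc]
      simp only [smul_mul', smul_inv', mul_smul]
      group
    have e : i (c' (σ, τ)) = i (b σ * σ • b τ * (b (σ * τ))⁻¹ * c (σ, τ)) := by
      rw [hc', hb' σ, hb' τ, hb' (σ * τ), smul_mul', ← h.map_smul_left, map_mul, ← hX, map_mul,
        map_mul, map_inv, mul_inv_rev, ← map_inv i]
      generalize g⁻¹ * N σ * σ • g = X
      generalize σ • (g⁻¹ * N τ * τ • g) = Y
      generalize (g⁻¹ * N (σ * τ) * (σ * τ) • g)⁻¹ = Z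
      calc i (b σ) * X * (i (σ • b τ) * Y) * (Z * i (b (σ * τ))⁻¹)
          = i (b σ) * (X * i (σ • b τ)) * Y * (Z * i (b (σ * τ))⁻¹) := by group
        _ = i (b σ) * i (σ • b τ) * (X * Y * Z * i (b (σ * τ))⁻¹) := by
            rw [← h.central (σ • b τ) X]; group
        _ = _ := by rw [← h.central (b (σ * τ))⁻¹ (X * Y * Z)]; simp only [mul_assoc]
    have := h.injective e
    rw [Pi.mul_apply, Pi.inv_apply, this]
    simp [mul_comm]

/-- The connecting map `H¹(Γ, K) → H²(Γ, C)` of a central extension: a `1`-cocycle `a` with any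
continuous lift `N : Γ → G` goes to the class of `(σ, τ) ↦ N σ · σ(N τ) · N(στ)⁻¹`. -/
noncomputable def connecting [IsTopologicalGroup Γ] (h : IsCentralExtension Γ i p) :
    H1 Γ K → H2 Γ C :=
  Quotient.lift
    (fun a => H2.mk
      (⟨(h.exists_lift a).choose_spec.choose,
        h.mem_Z2 (h.exists_lift a).choose_spec.choose_spec⟩ : Z2 Γ C))
    (fun a a' haa' => by
      rw [H2.mk_eq_mk]
      exact h.coboundary_unique haa' (h.exists_lift a).choose_spec.choose_spec
        (h.exists_lift a').choose_spec.choose_spec)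

/-- The connecting map may be computed with any continuous lift. -/
lemma connecting_mk [IsTopologicalGroup Γ] (h : IsCentralExtension Γ i p) (a : Z1 Γ K)
    {N : Γ → G} {c : Γ × Γ → C}
    (hN : IsLiftWithCoboundary i p a.1 N c) :
    h.connecting (Quotient.mk _ a) = H2.mk (⟨c, h.mem_Z2 hN⟩ : Z2 Γ C) := by
  refine H2.mk_eq_mk.2 ?_
  exact h.coboundary_unique ((Z1.setoid Γ K).refl a) (h.exists_lift a).choose_spec.choose_spec hN

end IsCentralExtension

end Connecting

section Schemes

open CategoryTheory AlgebraicGeometry MonoidalCategory CartesianMonoidalCategory MonObj Limits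
open scoped LaurentPolynomial

universe u

variable (k : Type u) [Field k]

/-- The absolute Galois group of `k` (for `k` perfect), with its Krull topology. -/
abbrev AbsGal : Type u := AlgebraicClosure k ≃ₐ[k] AlgebraicClosure k

/-- `Spec k̄` as a scheme over `Spec k`. -/
noncomputable abbrev geomPoint : Over (Spec (.of k)) :=
  (Spec (.of (AlgebraicClosure k))).asOver (Spec (.of k))

/-- The multiplicative group `𝔾ₘ = Spec k[T, T⁻¹]` over `k`, a commutative group scheme through the
Hopf algebra structure of `k[T, T⁻¹]` in which `T` is group-like. -/
noncomputable abbrev Gm : Over (Spec (.of k)) :=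
  (Spec (.of k[T;T⁻¹])).asOver (Spec (.of k))

variable {k}

/-- The automorphism of `Spec k̄` over `Spec k` given by a Galois element. -/
noncomputable def galSpec (σ : AbsGal k) : geomPoint k ⟶ geomPoint k :=
  (Spec.map (CommRingCat.ofHom
    (σ : AlgebraicClosure k →ₐ[k] AlgebraicClosure k).toRingHom)).asOver _

lemma galSpec_one : galSpec (1 : AbsGal k) = 𝟙 _ := by
  ext1
  exact Spec.map_id _

lemma galSpec_mul (σ τ : AbsGal k) : galSpec (σ * τ) = galSpec σ ≫ galSpec τ := by
  ext1
  exact Spec.map_comp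
    (CommRingCat.ofHom (τ : AlgebraicClosure k →ₐ[k] AlgebraicClosure k).toRingHom)
    (CommRingCat.ofHom (σ : AlgebraicClosure k →ₐ[k] AlgebraicClosure k).toRingHom)

/-- The set `X(k̄)` of geometric points of a `k`-scheme `X`. -/
def geomPoints (X : Over (Spec (.of k))) : Type u := geomPoint k ⟶ X

/-- The group structure on `G(k̄)` for a group scheme `G` over `k`. -/
noncomputable instance (G : Over (Spec (.of k))) [GrpObj G] : Group (geomPoints G) :=
  inferInstanceAs (Group (geomPoint k ⟶ G))

/-- The Galois action on `G(k̄)`. On an affine scheme `Spec R` it sends `R → k̄` to its composite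
with `σ : k̄ → k̄`. -/
noncomputable instance (G : Over (Spec (.of k))) [GrpObj G] :
    MulDistribMulAction (AbsGal k) (geomPoints G) where
  smul σ x := galSpec σ ≫ x
  one_smul x := (congrArg (· ≫ x) galSpec_one).trans (Category.id_comp x)
  mul_smul σ τ x := (congrArg (· ≫ x) (galSpec_mul σ τ)).trans (Category.assoc _ _ x)
  smul_mul σ x y := comp_mul (galSpec σ) x y
  smul_one σ := comp_one (galSpec σ)

lemma eventually_galois_comp_eq {X : Scheme.{u}} (g : X ⟶ Spec (.of k)) [LocallyOfFiniteType g]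
    (f : Spec (.of (AlgebraicClosure k)) ⟶ X)
    (hfg : f ≫ g = Spec.map (CommRingCat.ofHom (algebraMap k (AlgebraicClosure k)))) :
    ∀ᶠ σ : AbsGal k in nhds 1, Spec.map (CommRingCat.ofHom
      (σ : AlgebraicClosure k →ₐ[k] AlgebraicClosure k).toRingHom) ≫ f = f := by
  obtain ⟨R, j, hj, hx, -⟩ := Scheme.exists_affine_mem_range_and_range_subset
    (X := X) (x := f (IsLocalRing.closedPoint _)) (U := ⊤) trivial
  have hr : Set.range f ⊆ Set.range j := by
    rintro _ ⟨q, rfl⟩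
    rw [Subsingleton.elim q (IsLocalRing.closedPoint _)]
    exact hx
  obtain ⟨φ, hφ⟩ := Spec.map_surjective (IsOpenImmersion.lift j f hr)
  obtain ⟨ψ, hψ⟩ := Spec.map_surjective (j ≫ g)
  have hfin : ψ.hom.FiniteType := by
    have : LocallyOfFiniteType (Spec.map ψ) := by rw [hψ]; infer_instance
    exact (HasRingHomProperty.Spec_iff (P := @LocallyOfFiniteType)).1 this
  have hf : Spec.map φ ≫ j = f := by rw [hφ, IsOpenImmersion.lift_fac]
  have hcomp : ψ ≫ φ = CommRingCat.ofHom (algebraMap k (AlgebraicClosure k)) := by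
    apply Spec.map_injective
    rw [Spec.map_comp, hψ, reassoc_of% hf, hfg]
  let _ : Algebra k R := ψ.hom.toAlgebra
  obtain ⟨s, hs⟩ : (⊤ : Subalgebra k R).FG := hfin.1
  let φ' : R →ₐ[k] AlgebraicClosure k :=
    { φ.hom with commutes' := fun r => congrArg (fun h => h.hom r) hcomp }
  let E := IntermediateField.adjoin k (φ' '' (s : Set R))
  have : FiniteDimensional k E := by
    have : Finite (φ' '' (s : Set R)) := (s.finite_toSet.image _).to_subtype
    exact IntermediateField.finiteDimensional_adjoin fun y _ => Algebra.IsIntegral.isIntegral y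
  filter_upwards [E.fixingSubgroup_isOpen.mem_nhds (one_mem _)] with σ hσ
  have hσφ : (σ : AlgebraicClosure k →ₐ[k] AlgebraicClosure k).comp φ' = φ' := by
    refine AlgHom.ext_of_adjoin_eq_top hs fun r hr => ?_
    exact (IntermediateField.mem_fixingSubgroup_iff E σ).1 hσ _
      (IntermediateField.subset_adjoin k _ ⟨r, hr, rfl⟩)
  have hσφ' : φ ≫ CommRingCat.ofHom
      (σ : AlgebraicClosure k →ₐ[k] AlgebraicClosure k).toRingHom = φ := by
    ext r
    exact DFunLike.congr_fun hσφ r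
  rw [← hf, ← Category.assoc, ← Spec.map_comp, hσφ']

/-- The Galois group acts continuously on the discrete group `G(k̄)`, for `G` locally of finite
type over `k`. -/
lemma isLocallyConstant_smul {G : Over (Spec (.of k))} [GrpObj G] [LocallyOfFiniteType G.hom]
    (x : geomPoints G) : IsLocallyConstant fun σ : AbsGal k => σ • x := by
  have hx : ∀ᶠ σ : AbsGal k in nhds 1, σ • x = x := by
    filter_upwards [eventually_galois_comp_eq G.hom
      (CommaMorphism.left (X := geomPoint k) (Y := G) x)
      (Over.w (show geomPoint k ⟶ G from x))] with σ hσ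
    exact Over.OverMorphism.ext hσ
  rw [IsLocallyConstant.iff_eventually_eq]
  intro τ
  have ht : Filter.Tendsto (fun σ : AbsGal k => τ⁻¹ * σ) (nhds τ) (nhds 1) := by
    have := (continuous_const_mul (τ⁻¹)).tendsto τ
    rwa [inv_mul_cancel] at this
  filter_upwards [ht.eventually hx] with σ hσ
  rw [mul_smul, inv_smul_eq_iff] at hσ
  exact hσ

lemma exists_lift_of_surjective {F : Type u} [Field F] [IsAlgClosed F] {X Y : Scheme.{u}}
    (f : X ⟶ Y) [LocallyOfFiniteType f] [Surjective f] (y : Spec (.of F) ⟶ Y) :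
    ∃ x : Spec (.of F) ⟶ X, x ≫ f = y := by
  have : JacobsonSpace ↥(pullback f y) := LocallyOfFiniteType.jacobsonSpace (pullback.snd f y)
  obtain ⟨z, -⟩ := (pullback.snd f y).surjective (IsLocalRing.closedPoint _)
  obtain ⟨w, -, hw⟩ := nonempty_inter_closedPoints (Z := (Set.univ : Set ↥(pullback f y)))
    ⟨z, trivial⟩ isClosed_univ.isLocallyClosed
  refine ⟨pointOfClosedPoint (pullback.snd f y) w (mem_closedPoints_iff.1 hw) ≫
    pullback.fst f y, ?_⟩
  rw [Category.assoc, pullback.condition, pointOfClosedPoint_comp_assoc]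

lemma geomPoints_surjective {G K : Over (Spec (.of k))} [LocallyOfFiniteType G.hom] (π : G ⟶ K)
    [Surjective π.left] (y : geomPoint k ⟶ K) : ∃ x : geomPoint k ⟶ G, x ≫ π = y := by
  have : LocallyOfFiniteType (π.left ≫ K.hom) := by rw [Over.w]; infer_instance
  have : LocallyOfFiniteType π.left := locallyOfFiniteType_of_comp π.left K.hom
  obtain ⟨x, hx⟩ := exists_lift_of_surjective π.left y.left
  refine ⟨Over.homMk x ?_, Over.OverMorphism.ext hx⟩
  have h1 := Over.w π
  have h2 := Over.w y
  rw [← h2, ← hx, ← h1]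
  exact (Category.assoc _ _ _).symm

/-- A unit `u` of `F` corresponds to the homomorphism `m ↦ u ^ m`. -/
def unitsEquivHom (F : Type*) [CommGroupWithZero F] : Fˣ ≃* (Multiplicative ℤ →* F) where
  toFun u := (Units.coeHom F).comp (zpowersHom Fˣ u)
  invFun f := f.toHomUnits (Multiplicative.ofAdd 1)
  left_inv u := by ext; simp
  right_inv f := by ext; simp
  map_mul' u v := by ext; simp

/-- The identification `k̄ˣ = 𝔾ₘ(k̄)`: a unit `u` corresponds to the point `T ↦ u`. -/
noncomputable def unitsEquivGm : (AlgebraicClosure k)ˣ ≃* geomPoints (Gm k) :=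
  ((unitsEquivHom (AlgebraicClosure k)).trans
    (AddMonoidAlgebra.liftMulEquiv k (AlgebraicClosure k) ℤ)).trans
      (Spec.mapMulEquiv (R := k) (S := k[T;T⁻¹]) (T := AlgebraicClosure k))

lemma unitsEquivGm_smul (σ : AbsGal k) (u : (AlgebraicClosure k)ˣ) :
    unitsEquivGm (σ • u) = σ • unitsEquivGm u := by
  apply Over.OverMorphism.ext
  refine Eq.trans ?_ (Spec.map_comp _ _)
  refine congrArg Spec.map ?_
  ext1
  have key : AddMonoidAlgebra.lift k (AlgebraicClosure k) ℤ (unitsEquivHom _ (σ • u)) =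
      (σ : AlgebraicClosure k →ₐ[k] AlgebraicClosure k).comp
        (AddMonoidAlgebra.lift k (AlgebraicClosure k) ℤ (unitsEquivHom _ u)) := by
    apply AddMonoidAlgebra.algHom_ext
    · intro n
      rw [AlgHom.comp_apply, AddMonoidAlgebra.lift_single, AddMonoidAlgebra.lift_single]
      simp [unitsEquivHom]
    · exact Subsingleton.elim _ _
  exact congrArg AlgHom.toRingHom key

/-- The Brauer group `Br(k) = H²(k, 𝔾ₘ) = H²(Gal(k̄/k), k̄ˣ)` of a perfect field, written
multiplicatively. -/
abbrev Br (k : Type u) [Field k] : Type u := H2 (AbsGal k) (AlgebraicClosure k)ˣ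

/-- The `n`-torsion subgroup `Br(k)[n]`. -/
noncomputable def Br.torsion (k : Type u) [Field k] (n : ℕ) : Subgroup (Br k) := (powMonoidHom n).ker

/-- An abstract theta group over `k`: a group scheme `G` of finite type over `k` in a short exact
sequence `1 → 𝔾ₘ → G → K → 1`, with centre `𝔾ₘ`, where `K` is finite étale, `K(k̄) ≅ A ⊕ A` for a
finite abelian group `A`, and the characteristic of `k` does not divide the order of `K`. -/
structure AbstractThetaGroup (k : Type u) [Field k] where
  /-- The group scheme `G`. -/
  G : Over (Spec (.of k))
  /-- The quotient group scheme `K`. -/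
  K : Over (Spec (.of k))
  [grpG : GrpObj G]
  [grpK : GrpObj K]
  /-- The homomorphism `𝔾ₘ → G`. -/
  incl : Gm k ⟶ G
  /-- The homomorphism `G → K`. -/
  proj : G ⟶ K
  [isMonHom_incl : IsMonHom incl]
  [isMonHom_proj : IsMonHom proj]
  [locallyOfFiniteType : LocallyOfFiniteType G.hom]
  [quasiCompact : QuasiCompact G.hom]
  /-- `𝔾ₘ → G` is the kernel of `G → K`. -/
  isPullback : IsPullback incl (toUnit (Gm k)) proj η[K]
  /-- `G → K` is faithfully flat. -/
  [flat : Flat proj.left]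
  [surjective : Surjective proj.left]
  /-- The (functorial, scheme-theoretic) centre of `G` is `𝔾ₘ`. -/
  center : ∀ (S : Over (Spec (.of k))) (g : S ⟶ G),
    (∀ (S' : Over (Spec (.of k))) (f : S' ⟶ S) (h : S' ⟶ G), (f ≫ g) * h = h * (f ≫ g)) ↔
      ∃ c : S ⟶ Gm k, c ≫ incl = g
  [isFinite : IsFinite K.hom]
  [etale : Etale K.hom]
  exists_square : ∃ (A : Type) (_ : AddCommGroup A), Finite A ∧
    Nonempty (geomPoints K ≃* Multiplicative (A × A))
  char_not_dvd : ¬ ringChar k ∣ Nat.card (geomPoints K)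

namespace AbstractThetaGroup

attribute [instance] grpG grpK isMonHom_incl isMonHom_proj locallyOfFiniteType quasiCompact flat
  surjective isFinite etale

variable (T : AbstractThetaGroup k)

/-- `T` is of type `(n, …, n)`: the group `A` with `K(k̄) ≅ A ⊕ A` is `(ℤ/n)^g` for some `g`. -/
def IsOfType (n : ℕ) : Prop :=
  ∃ g : ℕ, Nonempty (geomPoints T.K ≃* Multiplicative ((Fin g → ZMod n) × (Fin g → ZMod n)))

/-- The inclusion `k̄ˣ = 𝔾ₘ(k̄) → G(k̄)`. -/
noncomputable def geomIncl : (AlgebraicClosure k)ˣ →* geomPoints T.G :=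
  MonoidHom.comp (N := geomPoints (Gm k)) (IsMonHom.monoidHom T.incl (geomPoint k))
    (unitsEquivGm (k := k)).toMonoidHom

/-- The projection `G(k̄) → K(k̄)`. -/
noncomputable def geomProj : geomPoints T.G →* geomPoints T.K :=
  IsMonHom.monoidHom T.proj (geomPoint k)

/-- The sequence `1 → k̄ˣ → G(k̄) → K(k̄) → 1` is a central extension of discrete Galois groups. -/
lemma isCentralExtension : IsCentralExtension (AbsGal k) T.geomIncl T.geomProj where
  injective := by
    have : Mono T.incl := T.isPullback.mono_fst_of_mono
    intro u v h
    exact unitsEquivGm.injective ((cancel_mono T.incl).1 h)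
  surjective y := geomPoints_surjective T.proj y
  exact := by
    ext x
    constructor
    · rintro ⟨u, rfl⟩
      have hu : ∀ y : geomPoint k ⟶ Gm k, (y ≫ T.incl) ≫ T.proj = toUnit _ ≫ η[T.K] := fun y => by
        rw [Category.assoc, T.isPullback.w, comp_toUnit_assoc]
      exact hu (unitsEquivGm u)
    · intro hx
      have hx' : (show geomPoint k ⟶ T.G from x) ≫ T.proj = toUnit _ ≫ η[T.K] := hx
      refine ⟨unitsEquivGm.symm (T.isPullback.lift x (toUnit _) hx'), ?_⟩
      refine (congrArg (fun y : geomPoint k ⟶ Gm k => y ≫ T.incl)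
        (unitsEquivGm.apply_symm_apply _)).trans ?_
      exact T.isPullback.lift_fst _ _ _
  central u g := by
    have := (T.center _ (T.geomIncl u)).2 ⟨unitsEquivGm u, rfl⟩ _ (𝟙 _) g
    exact (congrArg (· * g) (Category.id_comp (T.geomIncl u)).symm).trans
      (this.trans (congrArg (g * ·) (Category.id_comp (T.geomIncl u))))
  map_smul_left σ u := by
    refine (congrArg (fun y : geomPoint k ⟶ Gm k => y ≫ T.incl) (unitsEquivGm_smul σ u)).trans ?_
    exact Category.assoc _ _ _
  map_smul_right σ g := Category.assoc (galSpec σ) g T.proj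
  continuous_smul := isLocallyConstant_smul

/-- The obstruction map `Δ_G : H¹(k, K) → H²(k, 𝔾ₘ) = Br(k)`, the connecting map of
`1 → 𝔾ₘ → G → K → 1` in Galois cohomology. -/
noncomputable def obstruction : H1 (AbsGal k) (geomPoints T.K) → Br k :=
  T.isCentralExtension.connecting

end AbstractThetaGroup

end Schemes

end ThetaObstruction

/-! The point is that for odd `n` the `n`-th power map on `𝒢(k̄)` is a Galois-equivariant
homomorphism into `k̄ˣ`. It lands there because `n` kills `K(k̄)`. It is multiplicative because
`𝒢(k̄)` has class at most two: with `z = [y, x]` central, `(xy)ⁿ = z^(n choose 2) xⁿ yⁿ`. Since `yⁿ`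
is central, `zⁿ = 1`, and for odd `n` the exponent `n(n-1)/2` is a multiple of `n`, so the
correction disappears (`mul_pow_of_odd`).

Now lift a cocycle to `N` and apply this homomorphism to `c(σ, τ) = N_σ σ(N_τ) N_{στ}⁻¹`. The result
is that `cⁿ` is the coboundary of the cochain `Nⁿ`, whose values lie in `k̄ˣ`; hence the class of
`c` is killed by `n` (`connecting_pow_eq_one`). -/

namespace ThetaObstruction

/-! ### Power identities in groups of class two -/

section OddPower

variable {G : Type*} [Group G]

/-- Each of the `m` factors `y` that moves past `x` contributes one central factor `z`. -/
lemma pow_mul_eq_of_mul_eq_central {x y z : G} (hz : ∀ g, z * g = g * z)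
    (h : y * x = z * (x * y)) (m : ℕ) : y ^ m * x = z ^ m * (x * y ^ m) := by
  induction m with
  | zero => simp
  | succ m ih =>
    have hzm : y * z ^ m = z ^ m * y := ((show Commute z y from hz y).pow_left m).eq.symm
    rw [pow_succ', mul_assoc, ih, ← mul_assoc, hzm, mul_assoc, ← mul_assoc y, h, pow_succ]
    simp only [mul_assoc]

/-- The power formula in a group of class two: `(xy)ᵐ = [y, x]^(m choose 2) xᵐ yᵐ`. -/
lemma mul_pow_of_mul_eq_central {x y z : G} (hz : ∀ g, z * g = g * z)
    (h : y * x = z * (x * y)) (m : ℕ) :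
    (x * y) ^ m = z ^ m.choose 2 * (x ^ m * y ^ m) := by
  induction m with
  | zero => simp
  | succ m ih =>
    have hzm : x ^ m * z ^ m = z ^ m * x ^ m :=
      (((show Commute z x from hz x).pow_left m).pow_right m).eq.symm
    have hc : (m + 1).choose 2 = m.choose 2 + m := by
      rw [Nat.choose_succ_succ' m 1, Nat.choose_one_right, add_comm]
    calc (x * y) ^ (m + 1) = z ^ m.choose 2 * (x ^ m * (y ^ m * x) * y) := by
          rw [pow_succ, ih]; simp only [mul_assoc]
      _ = z ^ m.choose 2 * ((x ^ m * z ^ m) * (x * y ^ m * y)) := by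
          rw [pow_mul_eq_of_mul_eq_central hz h m]; simp only [mul_assoc]
      _ = z ^ (m + 1).choose 2 * (x ^ (m + 1) * y ^ (m + 1)) := by
          rw [hzm, hc, pow_add, pow_succ x, pow_succ y]; simp only [mul_assoc]

/-- For odd `n`, the `n`-th power map is multiplicative on a group of class two in which `n`-th
powers are central. -/
lemma mul_pow_of_odd {n : ℕ} (hn : Odd n) {x y z : G} (hz : ∀ g, z * g = g * z)
    (h : y * x = z * (x * y)) (hy : y ^ n * x = x * y ^ n) :
    (x * y) ^ n = x ^ n * y ^ n := by
  -- Moving `yⁿ` past `x` costs `zⁿ`, but `yⁿ` commutes with `x`.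
  have hzn : z ^ n = 1 := by
    have := pow_mul_eq_of_mul_eq_central hz h n
    rwa [hy, right_eq_mul] at this
  obtain ⟨t, ht⟩ := hn
  -- The only use of oddness: with `n = 2t + 1`, the exponent `n(n-1)/2` is `n * t`, so the
  -- correction factor is a power of `zⁿ`.
  have hc : n.choose 2 = n * t := by
    rw [Nat.choose_two_right, ht, Nat.add_sub_cancel, mul_left_comm,
      Nat.mul_div_cancel_left _ two_pos]
  rw [mul_pow_of_mul_eq_central hz h, hc, pow_mul, hzn, one_pow, one_mul]

end OddPower

/-! ### The connecting map of an extension of odd exponent -/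

namespace IsCentralExtension

variable {Γ : Type*} [Group Γ] [TopologicalSpace Γ]
variable {C G K : Type*} [CommGroup C] [Group G] [Group K]
variable [MulDistribMulAction Γ C] [MulDistribMulAction Γ G] [MulDistribMulAction Γ K]
variable {i : C →* G} {p : G →* K} {n : ℕ}

lemma exists_incl_eq_pow (h : IsCentralExtension Γ i p) (hK : ∀ a : K, a ^ n = 1) (x : G) :
    ∃ c, i c = x ^ n := by
  rw [← MonoidHom.mem_range, h.exact, MonoidHom.mem_ker, map_pow, hK]

/-- Commutators die in `K` because `K` is abelian, and `n`-th powers die because `K` has exponent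
dividing `n`. Both therefore come from the central subgroup `C`, as `mul_pow_of_odd` requires. -/
lemma mul_pow (h : IsCentralExtension Γ i p) (hn : Odd n) (hcomm : ∀ a b : K, a * b = b * a)
    (hK : ∀ a : K, a ^ n = 1) (x y : G) : (x * y) ^ n = x ^ n * y ^ n := by
  obtain ⟨c, hc⟩ : ∃ c, i c = y * x * (x * y)⁻¹ := by
    rw [← MonoidHom.mem_range, h.exact, MonoidHom.mem_ker, map_mul, map_inv, map_mul, map_mul,
      hcomm (p y), mul_inv_cancel]
  obtain ⟨d, hd⟩ := h.exists_incl_eq_pow hK y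
  exact mul_pow_of_odd hn (h.central c) (by rw [hc, inv_mul_cancel_right])
    (by rw [← hd, h.central])

/-- The connecting map of a central extension of an abelian group of odd exponent `n` takes values
in the `n`-torsion: the `n`-th power of the coboundary of `N` is the coboundary of `Nⁿ`. -/
lemma connecting_pow_eq_one [IsTopologicalGroup Γ] (h : IsCentralExtension Γ i p) (hn : Odd n)
    (hcomm : ∀ a b : K, a * b = b * a) (hK : ∀ a : K, a ^ n = 1) (a : H1 Γ K) :
    h.connecting a ^ n = 1 := by
  induction a using Quotient.inductionOn with | _ a
  obtain ⟨N, c, hN⟩ := h.exists_lift a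
  -- The equation is turned around so that the criterion asks for `1⁻¹ * cⁿ`, rather than its
  -- inverse, to be a coboundary.
  rw [h.connecting_mk a hN, ← map_pow, ← map_one H2.mk, eq_comm, H2.mk_eq_mk]
  obtain ⟨hN, -, hc⟩ := hN
  -- `b` is `Nⁿ` read in `C`. As `i` is injective, `b σ` is determined by `N σ`, so `b` inherits
  -- local constancy from `N`.
  choose b hb using fun σ => h.exists_incl_eq_pow hK (N σ)
  refine ⟨b, ?_, fun σ τ => h.injective ?_⟩
  · rw [IsLocallyConstant.iff_eventually_eq]
    intro x
    filter_upwards [(IsLocallyConstant.iff_eventually_eq _).1 hN x] with y e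
    apply h.injective
    rw [hb, hb, e]
  · have hi : i (c (σ, τ) ^ n) = i (b σ * σ • b τ * (b (σ * τ))⁻¹) := by
      rw [map_pow, hc, h.mul_pow hn hcomm hK, h.mul_pow hn hcomm hK, map_mul, map_mul, map_inv,
        h.map_smul_left, hb, hb, hb, smul_pow', inv_pow]
    simpa using hi

end IsCentralExtension

/-! ### Theta groups of type `(n, …, n)` -/

namespace AbstractThetaGroup

universe u

variable {k : Type u} [Field k] {T : AbstractThetaGroup k} {n : ℕ}

lemma IsOfType.mul_comm (hT : T.IsOfType n) (a b : geomPoints T.K) : a * b = b * a := by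
  obtain ⟨g, ⟨e⟩⟩ := hT
  apply e.injective
  rw [map_mul, map_mul, _root_.mul_comm]

lemma IsOfType.pow_eq_one (hT : T.IsOfType n) (a : geomPoints T.K) : a ^ n = 1 := by
  obtain ⟨g, ⟨e⟩⟩ := hT
  apply e.injective
  rw [map_pow, map_one]
  apply Multiplicative.toAdd.injective
  rw [toAdd_pow, toAdd_one]
  -- In each coordinate, multiplication by `n` is zero on `ZMod n`.
  ext <;> simp

end AbstractThetaGroup

end ThetaObstruction

theorem theorem27 {k : Type*} [Field k] [PerfectField k] (hk : ringChar k ≠ 2)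
    (n : ℕ) (hn : Odd n) (T : ThetaObstruction.AbstractThetaGroup k) (hT : T.IsOfType n) :
    Set.range T.obstruction ⊆ (ThetaObstruction.Br.torsion k n : Set (ThetaObstruction.Br k)) := by
  rintro _ ⟨a, rfl⟩
  exact T.isCentralExtension.connecting_pow_eq_one hn hT.mul_comm hT.pow_eq_one a
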